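/- Let $\mathbf{Z}$ be a Borel space, i.e., a measurable space isomorphic to a Borel subset of $\mathbb{R}$, and let $\mathfrak{P}(\mathbf{Z})$ be the set of all probability measures on $\mathbf{Z}$. Equip the space $\mathbf{Z}^{\infty}$ of infinite sequences with the product $\sigma$-algebra, and write $Q^{\infty}$ for the infinite product of $Q\in\mathfrak{P}(\mathbf{Z})$ with itself. A probability measure $R$ on $\mathbf{Z}^{\infty}$ is exchangeable if it is invariant with respect to swapping any pair of observations. For events $A\subseteq\mathbf{Z}^{\infty}$ and measurable functions $F:\mathbf{Z}^{\infty}\to[0,\infty]$ define $$\mathrm{UXP}(A):=\sup_{R}R(A),\quad \mathrm{URP}(A):=\sup_{Q\in\mathfrak{P}(\mathbf{Z})}Q^{\infty}(A),\quad \mathrm{UXE}(F):=\sup_{R}\int F\,dR,\quad \mathrm{URE}(F):=\sup_{Q\in\mathfrak{P}(\mathbf{Z})}\int F\,dQ^{\infty},$$ where $R$ ranges over the exchangeable probability measures on $\mathbf{Z}^{\infty}$. Then: 1. $\mathrm{UXP}(A)=\mathrm{URP}(A)$ for every event $A\subseteq\mathbf{Z}^{\infty}$. 2. $\mathrm{UXE}(F)=\mathrm{URE}(F)$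 for every measurable $F:\mathbf{Z}^{\infty}\to[0,\infty]$. 3. For every $\epsilon\in(0,1)$, the critical regions at level $\epsilon$ for testing exchangeability (events $A$ with $\mathrm{UXP}(A)\le\epsilon$) and for testing randomness (events $A$ with $\mathrm{URP}(A)\le\epsilon$) are the same. 4. Exchangeability p-variables (measurable $P:\mathbf{Z}^{\infty}\to[0,1]$ with $\mathrm{UXP}(P\le\epsilon)\le\epsilon$ for all $\epsilon\in(0,1)$) and randomness p-variables (measurable $P:\mathbf{Z}^{\infty}\to[0,1]$ with $\mathrm{URP}(P\le\epsilon)\le\epsilon$ for all $\epsilon\in(0,1)$) are the same. 5. Exchangeability e-variables (measurable $F:\mathbf{Z}^{\infty}\to[0,\infty]$ with $\mathrm{UXE}(F)\le1$) and randomness e-variables (measurable $F:\mathbf{Z}^{\infty}\to[0,\infty]$ with $\mathrm{URE}(F)\le1$) are the same. -/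

import Mathlib

open MeasureTheory
open scoped ENNReal

noncomputable section

/-- A probability measure on `Z^∞` is exchangeable if it is invariant with respect to swapping
any pair of observations. -/
def IsExchangeable {Z : Type*} [MeasurableSpace Z] (R : ProbabilityMeasure (ℕ → Z)) : Prop :=
  ∀ i j : ℕ, (R : Measure (ℕ → Z)).map (fun z n => z (Equiv.swap i j n)) = (R : Measure (ℕ → Z))

/-- The product measure `Q^∞` on `Z^∞`. -/
def iidMeasure {Z : Type*} [MeasurableSpace Z] (Q : ProbabilityMeasure Z) : Measure (ℕ → Z) :=
  Measure.infinitePi (fun _ : ℕ => (Q : Measure Z))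

/-- Upper exchangeability probability. -/
def UXP {Z : Type*} [MeasurableSpace Z] (A : Set (ℕ → Z)) : ℝ≥0∞ :=
  ⨆ (R : ProbabilityMeasure (ℕ → Z)) (_ : IsExchangeable R), (R : Measure (ℕ → Z)) A

/-- Upper randomness probability. -/
def URP {Z : Type*} [MeasurableSpace Z] (A : Set (ℕ → Z)) : ℝ≥0∞ :=
  ⨆ Q : ProbabilityMeasure Z, iidMeasure Q A

/-- Upper exchangeability expectation. -/
def UXE {Z : Type*} [MeasurableSpace Z] (F : (ℕ → Z) → ℝ≥0∞) : ℝ≥0∞ :=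
  ⨆ (R : ProbabilityMeasure (ℕ → Z)) (_ : IsExchangeable R), ∫⁻ z, F z ∂(R : Measure (ℕ → Z))

/-- Upper randomness expectation. -/
def URE {Z : Type*} [MeasurableSpace Z] (F : (ℕ → Z) → ℝ≥0∞) : ℝ≥0∞ :=
  ⨆ Q : ProbabilityMeasure Z, ∫⁻ z, F z ∂(iidMeasure Q)

/-- Critical region at level `ε` for testing exchangeability. -/
def IsExchangeabilityCriticalRegion {Z : Type*} [MeasurableSpace Z] (ε : ℝ)
    (A : Set (ℕ → Z)) : Prop :=
  MeasurableSet A ∧ UXP A ≤ ENNReal.ofReal ε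

/-- Critical region at level `ε` for testing randomness. -/
def IsRandomnessCriticalRegion {Z : Type*} [MeasurableSpace Z] (ε : ℝ)
    (A : Set (ℕ → Z)) : Prop :=
  MeasurableSet A ∧ URP A ≤ ENNReal.ofReal ε

/-- Exchangeability p-variable, with values in `[0,1]`. -/
def IsExchangeabilityPVariable {Z : Type*} [MeasurableSpace Z]
    (P : (ℕ → Z) → unitInterval) : Prop :=
  Measurable P ∧ ∀ ε ∈ Set.Ioo (0 : ℝ) 1, UXP {z | (P z : ℝ) ≤ ε} ≤ ENNReal.ofReal ε

/-- Randomness p-variable, with values in `[0,1]`. -/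
def IsRandomnessPVariable {Z : Type*} [MeasurableSpace Z]
    (P : (ℕ → Z) → unitInterval) : Prop :=
  Measurable P ∧ ∀ ε ∈ Set.Ioo (0 : ℝ) 1, URP {z | (P z : ℝ) ≤ ε} ≤ ENNReal.ofReal ε

/-- Exchangeability e-variable, with values in `[0,∞]`. -/
def IsExchangeabilityEVariable {Z : Type*} [MeasurableSpace Z]
    (F : (ℕ → Z) → ℝ≥0∞) : Prop :=
  Measurable F ∧ UXE F ≤ 1

/-- Randomness e-variable, with values in `[0,∞]`. -/
def IsRandomnessEVariable {Z : Type*} [MeasurableSpace Z]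
    (F : (ℕ → Z) → ℝ≥0∞) : Prop :=
  Measurable F ∧ URE F ≤ 1

end

/-! By de Finetti's theorem (`IsExchangeable.eq_bind`) an exchangeable law on infinite sequences is
a mixture of i.i.d. laws, so its integral of `F` is an average of the i.i.d. integrals and cannot
exceed their supremum. Conversely, i.i.d. laws are exchangeable (`isExchangeable_iidMeasure`). The
two upper expectations therefore agree, and the other claims follow.

De Finetti's theorem rests on an L² argument. For bounded `f` the variables `f (z i)` have constant
pairwise inner products, so their averages are Cauchy in L² and converge almost surely along a
subsequence to an exchangeable limit. For `f` the indicator of `s`, this limit is the conditional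
probability of `z 0 ∈ s` given the exchangeable σ-algebra. An average may ignore any finite set of
indices, so each factor of a cylinder event can in turn be replaced by its conditional probability.
-/

open Filter Topology ProbabilityTheory

/-! ### Averages in Hilbert space -/

/-- The averages of vectors with constant pairwise inner products form a Cauchy sequence. -/
theorem cauchySeq_average_of_inner_eq {E : Type*} [NormedAddCommGroup E] [InnerProductSpace ℝ E]
    {x : ℕ → E} {c d : ℝ} (hx : ∀ i j, inner ℝ (x i) (x j) = if i = j then d else c) :
    CauchySeq fun n : ℕ => (n : ℝ)⁻¹ • ∑ i ∈ Finset.range n, x i := by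
  set a : ℕ → E := fun n => (n : ℝ)⁻¹ • ∑ i ∈ Finset.range n, x i with ha
  -- For `n ≤ m`, each of the `n` rows of the Gram sum contains exactly one diagonal entry.
  have hin : ∀ n m : ℕ, 0 < n → n ≤ m → inner ℝ (a n) (a m) = c + (d - c) / m := by
    intro n m hn hnm
    have hn' : (n : ℝ) ≠ 0 := by positivity
    have hm' : (m : ℝ) ≠ 0 := by
      have : 0 < m := hn.trans_le hnm
      positivity
    have h1 : ∀ i ∈ Finset.range n, ∑ j ∈ Finset.range m, inner ℝ (x i) (x j) = m * c + (d - c) := by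
      intro i hi
      have hi' : i ∈ Finset.range m := by simp at hi ⊢; omega
      have : ∀ j, inner ℝ (x i) (x j) = c + if i = j then d - c else 0 := by
        intro j; rw [hx]; split_ifs <;> ring
      simp only [this, Finset.sum_add_distrib, Finset.sum_ite_eq, if_pos hi']
      simp
    simp only [ha]
    rw [real_inner_smul_left, real_inner_smul_right, sum_inner]
    simp only [inner_sum]
    rw [Finset.sum_congr rfl h1, Finset.sum_const, Finset.card_range, nsmul_eq_mul]
    field_simp
  have hdc : ∀ n m : ℕ, 0 < n → n ≤ m → ‖a m - a n‖ ^ 2 = (d - c) / n - (d - c) / m := by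
    intro n m hn hnm
    rw [norm_sub_sq_real, ← real_inner_self_eq_norm_sq, ← real_inner_self_eq_norm_sq,
      real_inner_comm (a n) (a m), hin n m hn hnm, hin m m (hn.trans_le hnm) le_rfl, hin n n hn le_rfl]
    ring
  -- The case `n = 1`, `m = 2` of `hdc` equates `(d - c) / 2` with a square.
  have hcd : 0 ≤ d - c := by
    have h := hdc 1 2 (by norm_num) (by norm_num)
    have := sq_nonneg ‖a 2 - a 1‖
    norm_num at h
    linarith
  rw [Metric.cauchySeq_iff']
  intro ε hε
  obtain ⟨N, hN⟩ := exists_nat_gt ((d - c) / ε ^ 2)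
  have hN0 : 0 < N := by
    have : (0 : ℝ) < N := lt_of_le_of_lt (by positivity) hN
    exact_mod_cast this
  refine ⟨N, fun n hn => ?_⟩
  rw [dist_eq_norm]
  refine lt_of_pow_lt_pow_left₀ 2 hε.le ?_
  rw [hdc N n hN0 hn]
  have h1 : 0 ≤ (d - c) / (n : ℝ) := by positivity
  have h2 : (d - c) / (N : ℝ) < ε ^ 2 := by
    rw [div_lt_iff₀ (by positivity)] at hN ⊢
    linarith
  linarith

/-! ### Convergence of empirical averages -/

section Exchangeable

variable {Z : Type*} [MeasurableSpace Z]

theorem measurable_swap_coords (i j : ℕ) :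
    Measurable fun (z : ℕ → Z) n => z (Equiv.swap i j n) := by fun_prop

theorem IsExchangeable.integral_swap {R : ProbabilityMeasure (ℕ → Z)} (hR : IsExchangeable R)
    (i j : ℕ) {g : (ℕ → Z) → ℝ} (hg : Measurable g) :
    ∫ z, g (fun n => z (Equiv.swap i j n)) ∂(R : Measure (ℕ → Z)) = ∫ z, g z ∂(R : Measure _) := by
  conv_rhs => rw [← hR i j]
  rw [integral_map (measurable_swap_coords i j).aemeasurable hg.aestronglyMeasurable]

theorem IsExchangeable.integral_mul_eq {R : ProbabilityMeasure (ℕ → Z)} (hR : IsExchangeable R)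
    {f : Z → ℝ} (hf : Measurable f) (i j : ℕ) :
    ∫ z, f (z i) * f (z j) ∂(R : Measure (ℕ → Z)) =
      if i = j then ∫ z, f (z 0) * f (z 0) ∂(R : Measure (ℕ → Z))
      else ∫ z, f (z 0) * f (z 1) ∂(R : Measure (ℕ → Z)) := by
  have key : ∀ a b i j : ℕ, ∫ z, f (z (Equiv.swap a b i)) * f (z (Equiv.swap a b j))
      ∂(R : Measure (ℕ → Z)) = ∫ z, f (z i) * f (z j) ∂(R : Measure (ℕ → Z)) := fun a b i j =>
    hR.integral_swap a b (g := fun z => f (z i) * f (z j)) (by fun_prop)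
  split_ifs with h
  · subst h
    rw [← key 0 i i i]
    simp
  · rw [← key 0 i i j]
    -- A first swap sends `i` to 0 and a second sends the image of `j` to 1; as that image is not 0,
    -- the second swap leaves 0 in place.
    have h0 : Equiv.swap 0 i j ≠ 0 := fun h' => h (by
      have := congrArg (Equiv.swap 0 i) h'
      simpa using this.symm)
    rw [Equiv.swap_apply_right, ← key 1 (Equiv.swap 0 i j) 0,
      Equiv.swap_apply_right, Equiv.swap_apply_of_ne_of_ne (by norm_num) h0.symm]

/-- Along a subsequence, empirical averages converge almost surely. -/
theorem IsExchangeable.exists_subseq_average_tendsto {R : ProbabilityMeasure (ℕ → Z)}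
    (hR : IsExchangeable R) {f : Z → ℝ} (hf : Measurable f) (hb : ∀ x, |f x| ≤ 1) :
    ∃ ns : ℕ → ℕ, StrictMono ns ∧ ∀ᵐ z ∂(R : Measure (ℕ → Z)), ∃ l,
      Tendsto (fun k => (ns k : ℝ)⁻¹ * ∑ i ∈ Finset.range (ns k), f (z i)) atTop (𝓝 l) := by
  have hL : ∀ i : ℕ, MemLp (fun z : ℕ → Z => f (z i)) 2 (R : Measure (ℕ → Z)) := fun i =>
    MemLp.of_bound (by fun_prop : Measurable _).aestronglyMeasurable 1 (ae_of_all _ fun z => hb _)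
  let X : ℕ → Lp ℝ 2 (R : Measure (ℕ → Z)) := fun i => (hL i).toLp
  have hX : ∀ i, X i =ᵐ[(R : Measure (ℕ → Z))] fun z => f (z i) := fun i => (hL i).coeFn_toLp
  have hin : ∀ i j, inner ℝ (X i) (X j) =
      if i = j then ∫ z, f (z 0) * f (z 0) ∂(R : Measure (ℕ → Z))
      else ∫ z, f (z 0) * f (z 1) ∂(R : Measure (ℕ → Z)) := by
    intro i j
    rw [L2.inner_def, ← hR.integral_mul_eq hf i j]
    refine integral_congr_ae ?_
    filter_upwards [hX i, hX j] with z h1 h2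
    simp [h1, h2, mul_comm]
  obtain ⟨y, hy⟩ := cauchySeq_tendsto_of_complete (cauchySeq_average_of_inner_eq hin)
  obtain ⟨ns, hns, hlim⟩ := (tendstoInMeasure_of_tendsto_Lp hy).exists_seq_tendsto_ae
  refine ⟨ns, hns, ?_⟩
  have hsum : ∀ n : ℕ, ⇑((n : ℝ)⁻¹ • ∑ i ∈ Finset.range n, X i) =ᵐ[(R : Measure (ℕ → Z))]
      fun z => (n : ℝ)⁻¹ * ∑ i ∈ Finset.range n, f (z i) := by
    intro n
    filter_upwards [Lp.coeFn_smul (n : ℝ)⁻¹ (∑ i ∈ Finset.range n, X i),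
      Lp.coeFn_finsetSum (Finset.range n) X, ae_all_iff.2 hX] with z h1 h2 h3
    rw [h1, Pi.smul_apply, h2, Finset.sum_apply, smul_eq_mul]
    simp only [h3]
  filter_upwards [hlim, ae_all_iff.2 hsum] with z h1 h2
  exact ⟨y z, by simpa only [h2] using h1⟩

end Exchangeable

theorem sum_range_comp_swap {Z : Type*} (f : Z → ℝ) {i j n : ℕ} (hi : i < n) (hj : j < n) (z : ℕ → Z) :
    ∑ k ∈ Finset.range n, f (z (Equiv.swap i j k)) = ∑ k ∈ Finset.range n, f (z k) := by
  refine Finset.sum_equiv (Equiv.swap i j) (fun k => ?_) fun _ _ => rfl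
  simp only [Finset.mem_range]
  rw [Equiv.swap_apply_def]
  split_ifs <;> omega

theorem abs_average_le_one {Z : Type*} {f : Z → ℝ} (hb : ∀ x, |f x| ≤ 1) (n : ℕ) (z : ℕ → Z) :
    |(n : ℝ)⁻¹ * ∑ i ∈ Finset.range n, f (z i)| ≤ 1 := by
  rw [abs_mul, abs_of_nonneg (by positivity)]
  have : |∑ i ∈ Finset.range n, f (z i)| ≤ n :=
    (Finset.abs_sum_le_sum_abs _ _).trans
      ((Finset.sum_le_sum fun i _ => hb (z i)).trans (by simp))
  calc (n : ℝ)⁻¹ * |∑ i ∈ Finset.range n, f (z i)| ≤ (n : ℝ)⁻¹ * n := by gcongr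
    _ ≤ 1 := inv_mul_le_one

/-! ### The exchangeable σ-algebra -/

section ExchangeableSigmaAlgebra

variable {Z : Type*} [MeasurableSpace Z]

/-- The σ-algebra of events invariant under finite permutations of the coordinates. -/
@[reducible]
def exchangeableSigmaAlgebra (Z : Type*) [MeasurableSpace Z] : MeasurableSpace (ℕ → Z) :=
  ⨅ (i : ℕ) (j : ℕ), MeasurableSpace.invariants fun z n => z (Equiv.swap i j n)

theorem exchangeableSigmaAlgebra_le :
    exchangeableSigmaAlgebra Z ≤ (MeasurableSpace.pi : MeasurableSpace (ℕ → Z)) :=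
  (iInf₂_le 0 0).trans (MeasurableSpace.invariants_le _)

theorem measurable_exchangeableSigmaAlgebra {g : (ℕ → Z) → ℝ} (hg : Measurable g)
    (h : ∀ i j z, g (fun n => z (Equiv.swap i j n)) = g z) :
    Measurable[exchangeableSigmaAlgebra Z] g := by
  intro s hs
  simp only [MeasurableSpace.measurableSet_iInf, MeasurableSpace.measurableSet_invariants]
  refine fun i j => ⟨hg hs, ?_⟩
  ext z
  simp [h]

theorem comp_swap_of_measurable_exchangeableSigmaAlgebra {g : (ℕ → Z) → ℝ}
    (hg : Measurable[exchangeableSigmaAlgebra Z] g) (i j : ℕ) (z : ℕ → Z) :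
    g (fun n => z (Equiv.swap i j n)) = g z :=
  congrFun (MeasurableSpace.comp_eq_of_measurable_invariants
    (f := fun (z : ℕ → Z) n => z (Equiv.swap i j n))
    (hg.mono (iInf₂_le (f := fun i j => MeasurableSpace.invariants fun (z : ℕ → Z) n =>
      z (Equiv.swap i j n)) i j) le_rfl)) z

/-- For an exchangeable law, empirical averages have an exchangeable limit along a subsequence. -/
theorem IsExchangeable.exists_average_limit {R : ProbabilityMeasure (ℕ → Z)}
    (hR : IsExchangeable R) {f : Z → ℝ} (hf : Measurable f) (hb : ∀ x, |f x| ≤ 1) :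
    ∃ (g : (ℕ → Z) → ℝ) (ns : ℕ → ℕ), Measurable[exchangeableSigmaAlgebra Z] g ∧ StrictMono ns ∧
      ∀ᵐ z ∂(R : Measure (ℕ → Z)),
        Tendsto (fun k => (ns k : ℝ)⁻¹ * ∑ i ∈ Finset.range (ns k), f (z i)) atTop (𝓝 (g z)) := by
  obtain ⟨ns, hns, hlim⟩ := hR.exists_subseq_average_tendsto hf hb
  -- The limsup is defined everywhere and exactly invariant: a swap of `i` and `j` leaves every
  -- average over more than `max i j` terms unchanged.
  refine ⟨fun z => limsup (fun k => (ns k : ℝ)⁻¹ * ∑ i ∈ Finset.range (ns k), f (z i)) atTop, ns,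
    measurable_exchangeableSigmaAlgebra (Measurable.limsup fun k => by fun_prop) ?_, hns, ?_⟩
  · intro i j z
    refine limsup_congr ?_
    filter_upwards [hns.tendsto_atTop.eventually_gt_atTop i,
      hns.tendsto_atTop.eventually_gt_atTop j] with k hi hj
    rw [sum_range_comp_swap f hi hj z]
  · filter_upwards [hlim] with z ⟨l, hl⟩
    rwa [hl.limsup_eq]

/-- Dominated convergence moves the limit outside the integral, leaving Cesàro means of a sequence
eventually equal to `e`. Only large `j` matter, so `H` may depend on the early coordinates. -/
theorem integral_mul_average_limit {μ : Measure (ℕ → Z)} [IsProbabilityMeasure μ]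
    {f : Z → ℝ} (hf : Measurable f) (hb : ∀ x, |f x| ≤ 1) {g : (ℕ → Z) → ℝ} {ns : ℕ → ℕ}
    (hns : StrictMono ns)
    (hg : ∀ᵐ z ∂μ,
      Tendsto (fun k => (ns k : ℝ)⁻¹ * ∑ i ∈ Finset.range (ns k), f (z i)) atTop (𝓝 (g z)))
    {H : (ℕ → Z) → ℝ} (hH : Measurable H) (hHb : ∀ z, |H z| ≤ 1) {k : ℕ} {e : ℝ}
    (he : ∀ j, k ≤ j → ∫ z, H z * f (z j) ∂μ = e) :
    ∫ z, H z * g z ∂μ = e := by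
  have h1 : Tendsto (fun n => ∫ z, H z * ((ns n : ℝ)⁻¹ * ∑ i ∈ Finset.range (ns n), f (z i)) ∂μ)
      atTop (𝓝 (∫ z, H z * g z ∂μ)) := by
    refine tendsto_integral_of_dominated_convergence (fun _ => 1)
      (fun n => (by fun_prop : Measurable _).aestronglyMeasurable) (integrable_const _)
      (fun n => ae_of_all _ fun z => ?_) ?_
    · rw [Real.norm_eq_abs, abs_mul]
      exact mul_le_one₀ (hHb z) (abs_nonneg _) (abs_average_le_one hb _ z)
    · filter_upwards [hg] with z hz using hz.const_mul _
  have hint : ∀ j, Integrable (fun z => H z * f (z j)) μ := fun j =>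
    Integrable.of_bound (by fun_prop : Measurable _).aestronglyMeasurable 1 (ae_of_all _ fun z => by
      rw [Real.norm_eq_abs, abs_mul]
      exact mul_le_one₀ (hHb z) (abs_nonneg _) (hb _))
  have h2 : ∀ n : ℕ, ∫ z, H z * ((n : ℝ)⁻¹ * ∑ i ∈ Finset.range n, f (z i)) ∂μ =
      (n : ℝ)⁻¹ * ∑ i ∈ Finset.range n, ∫ z, H z * f (z i) ∂μ := by
    intro n
    rw [← integral_finsetSum _ fun j _ => hint j, ← integral_const_mul]
    congr 1 with z
    rw [Finset.mul_sum, Finset.mul_sum, Finset.mul_sum]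
    exact Finset.sum_congr rfl fun i _ => by ring
  have h3 : Tendsto (fun j => ∫ z, H z * f (z j) ∂μ) atTop (𝓝 e) :=
    tendsto_const_nhds.congr' (by
      filter_upwards [eventually_ge_atTop k] with j hj using (he j hj).symm)
  simp only [h2] at h1
  exact tendsto_nhds_unique h1 (h3.cesaro.comp hns.tendsto_atTop)

theorem measurable_eval_zero : Measurable fun z : ℕ → Z => z 0 := measurable_pi_apply 0

/-! ### The directing measure and de Finetti's theorem -/

variable [StandardBorelSpace Z]

/-- The conditional law of an observation given the exchangeable σ-algebra. -/
noncomputable def directingMeasure (R : ProbabilityMeasure (ℕ → Z)) (z : ℕ → Z) : Measure Z :=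
  (condExpKernel (R : Measure (ℕ → Z)) (exchangeableSigmaAlgebra Z) z).map fun w => w 0

instance (R : ProbabilityMeasure (ℕ → Z)) (z : ℕ → Z) :
    IsProbabilityMeasure (directingMeasure R z) :=
  Measure.isProbabilityMeasure_map (measurable_pi_apply 0).aemeasurable

theorem measurable_directingMeasure_apply (R : ProbabilityMeasure (ℕ → Z)) {s : Set Z}
    (hs : MeasurableSet s) :
    Measurable[exchangeableSigmaAlgebra Z] fun z => directingMeasure R z s := by
  simp only [directingMeasure, Measure.map_apply measurable_eval_zero hs]
  exact measurable_condExpKernel (measurable_eval_zero hs)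

/-- The limit of the empirical frequencies of `s` is a version of the conditional probability of `z
0 ∈ s`, hence equals the directing measure of `s` almost surely; `integral_mul_average_limit` then
applies. -/
theorem IsExchangeable.integral_mul_directingMeasure {R : ProbabilityMeasure (ℕ → Z)}
    (hR : IsExchangeable R) {s : Set Z} (hs : MeasurableSet s)
    {H : (ℕ → Z) → ℝ} (hH : Measurable H) (hHb : ∀ z, |H z| ≤ 1) {k : ℕ} {e : ℝ}
    (he : ∀ j, k ≤ j → ∫ z, H z * s.indicator 1 (z j) ∂(R : Measure (ℕ → Z)) = e) :
    ∫ z, H z * (directingMeasure R z).real s ∂(R : Measure (ℕ → Z)) = e := by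
  have hf : Measurable (s.indicator 1 : Z → ℝ) := measurable_one.indicator hs
  have hb : ∀ x, |(s.indicator 1 : Z → ℝ) x| ≤ 1 := fun x => by
    by_cases h : x ∈ s <;> simp [h]
  obtain ⟨g, ns, hgm, hns, hg⟩ := hR.exists_average_limit hf hb
  have hm := exchangeableSigmaAlgebra_le (Z := Z)
  have hgb : ∀ᵐ z ∂(R : Measure (ℕ → Z)), ‖g z‖ ≤ 1 := by
    filter_upwards [hg] with z hz
    exact le_of_tendsto hz.norm (Eventually.of_forall fun n => abs_average_le_one hb _ z)
  have hgi : Integrable g (R : Measure (ℕ → Z)) :=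
    Integrable.of_bound (hgm.mono hm le_rfl).aestronglyMeasurable 1 hgb
  have hgp : g =ᵐ[(R : Measure (ℕ → Z))] fun z => (directingMeasure R z).real s := by
    have h0 : MeasurableSet ((fun w : ℕ → Z => w 0) ⁻¹' s) := measurable_eval_zero hs
    have h1 : g =ᵐ[(R : Measure (ℕ → Z))] (R : Measure (ℕ → Z))[
        ((fun w : ℕ → Z => w 0) ⁻¹' s).indicator (fun _ => (1 : ℝ)) | exchangeableSigmaAlgebra Z] := by
      refine ae_eq_condExp_of_forall_setIntegral_eq hm
        ((integrable_const _).indicator h0) (fun _ _ _ => hgi.integrableOn) (fun T hT _ => ?_)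
        hgm.aestronglyMeasurable
      have hT' := hm _ hT
      have hTm : Measurable[exchangeableSigmaAlgebra Z] (T.indicator (fun _ => (1 : ℝ))) :=
        measurable_const.indicator hT
      have := integral_mul_average_limit hf hb hns hg (H := T.indicator fun _ => 1)
        (k := 0) (hTm.mono hm le_rfl)
        (fun z => by by_cases h : z ∈ T <;> simp [h])
        (e := ∫ z, T.indicator (fun _ => (1 : ℝ)) z * s.indicator 1 (z 0) ∂(R : Measure (ℕ → Z)))
        fun j _ => by
          -- The swap preserves the invariant event `T` and exchanges `z 0` with `z j`.
          rw [← hR.integral_swap 0 j]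
          · simp [comp_swap_of_measurable_exchangeableSigmaAlgebra hTm]
          · exact (hTm.mono hm le_rfl).mul (hf.comp (measurable_pi_apply j))
      rw [← integral_indicator hT', ← integral_indicator hT']
      convert this using 2
      · ext z; by_cases h : z ∈ T <;> simp [h]
      · ext z
        by_cases h : z ∈ T
        · rw [Set.indicator_of_mem h, Set.indicator_of_mem h, one_mul]
          rfl
        · simp [h]
    refine h1.trans ((condExpKernel_ae_eq_condExp hm h0).symm.trans (ae_of_all _ fun z => ?_))
    simp only [directingMeasure, Measure.real, Measure.map_apply measurable_eval_zero hs]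
  rw [← integral_mul_average_limit hf hb hns hg hH hHb he]
  refine integral_congr_ae ?_
  filter_upwards [hgp] with z hz
  rw [hz]

/-- The coordinates are conditionally independent given the exchangeable σ-algebra. -/
theorem IsExchangeable.integral_prod_indicator {R : ProbabilityMeasure (ℕ → Z)}
    (hR : IsExchangeable R) {s : ℕ → Set Z} (hs : ∀ i, MeasurableSet (s i)) (k : ℕ)
    {G : (ℕ → Z) → ℝ} (hG : Measurable[exchangeableSigmaAlgebra Z] G) (hGb : ∀ z, |G z| ≤ 1) :
    ∫ z, (∏ i ∈ Finset.range k, ((s i).indicator 1 (z i) : ℝ)) * G z ∂(R : Measure (ℕ → Z)) =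
      ∫ z, (∏ i ∈ Finset.range k, (directingMeasure R z).real (s i)) * G z
        ∂(R : Measure (ℕ → Z)) := by
  have hm := exchangeableSigmaAlgebra_le (Z := Z)
  have hind : ∀ i, Measurable ((s i).indicator 1 : Z → ℝ) := fun i => measurable_one.indicator (hs i)
  induction k generalizing G with
  | zero => simp
  | succ k ih =>
    have hG' : Measurable G := hG.mono hm le_rfl
    have hp : Measurable[exchangeableSigmaAlgebra Z] fun z => (directingMeasure R z).real (s k) :=
      (measurable_directingMeasure_apply R (hs k)).ennreal_toReal
    have hb : ∀ z : ℕ → Z, |∏ i ∈ Finset.range k, ((s i).indicator 1 (z i) : ℝ)| ≤ 1 := fun z => by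
      rw [Finset.abs_prod]
      refine Finset.prod_le_one (fun i _ => abs_nonneg _) fun i _ => ?_
      by_cases h : z i ∈ s i <;> simp [h]
    have hH : Measurable fun z : ℕ → Z =>
        (∏ i ∈ Finset.range k, ((s i).indicator 1 (z i) : ℝ)) * G z :=
      (Finset.measurable_fun_prod _ fun i _ => (hind i).comp (measurable_pi_apply i)).mul hG'
    have key := hR.integral_mul_directingMeasure (hs k)
      (H := fun z => (∏ i ∈ Finset.range k, ((s i).indicator 1 (z i) : ℝ)) * G z) hH
      (fun z => by
        rw [abs_mul]
        exact mul_le_one₀ (hb z) (abs_nonneg _) (hGb z)) (k := k)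
      (e := ∫ z, (∏ i ∈ Finset.range k, (s i).indicator 1 (z i)) * G z * (s k).indicator 1 (z k)
        ∂(R : Measure (ℕ → Z))) fun j hj => by
        -- Since `j ≥ k`, this swap fixes all coordinates below `k`, and `G` is invariant.
        refine (hR.integral_swap k j
          (hH.mul ((hind k).comp (measurable_pi_apply j)))).symm.trans ?_
        congr 1 with z
        simp only [Pi.mul_apply, Function.comp_apply]
        rw [comp_swap_of_measurable_exchangeableSigmaAlgebra hG, Equiv.swap_apply_right]
        congr 2
        refine Finset.prod_congr rfl fun i hi => ?_
        have hi' := Finset.mem_range.1 hi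
        rw [Equiv.swap_apply_of_ne_of_ne (by omega) (by omega)]
    -- The new factor is exchangeable-measurable, so it is absorbed into `G`; this is why the
    -- induction generalizes `G`.
    have step := ih (G := fun z => (directingMeasure R z).real (s k) * G z) (hp.mul hG) fun z => by
      rw [abs_mul, abs_of_nonneg measureReal_nonneg]
      exact mul_le_one₀ measureReal_le_one (abs_nonneg _) (hGb z)
    calc _ = _ := by
          congr 1 with z
          rw [Finset.prod_range_succ, mul_right_comm]
      _ = _ := key.symm
      _ = _ := by
          congr 1 with z
          rw [mul_assoc, mul_comm (G z)]
      _ = _ := step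
      _ = _ := by
          congr 1 with z
          rw [Finset.prod_range_succ, mul_assoc]

theorem measurable_iid_directingMeasure (R : ProbabilityMeasure (ℕ → Z)) :
    Measurable fun z => Measure.infinitePi fun _ : ℕ => directingMeasure R z := by
  refine .measure_of_isPiSystem_of_isProbabilityMeasure generateFrom_squareCylinders.symm
    (isPiSystem_squareCylinders (fun _ => MeasurableSpace.isPiSystem_measurableSet)
      fun _ => MeasurableSet.univ) ?_
  rintro _ ⟨I, t, ht, rfl⟩
  simp only [Set.mem_univ_pi, Set.mem_ofPred_eq] at ht
  simp only [Measure.infinitePi_pi _ fun i _ => ht i]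
  exact Finset.measurable_fun_prod _ fun i _ =>
    (measurable_directingMeasure_apply R (ht i)).mono exchangeableSigmaAlgebra_le le_rfl

/-- **De Finetti's theorem**: an exchangeable law is the mixture of the i.i.d. laws of its
directing measure. -/
theorem IsExchangeable.eq_bind {R : ProbabilityMeasure (ℕ → Z)} (hR : IsExchangeable R) :
    (R : Measure (ℕ → Z)) =
      (R : Measure (ℕ → Z)).bind fun z => Measure.infinitePi fun _ : ℕ => directingMeasure R z := by
  have hmeas := measurable_iid_directingMeasure R
  refine ext_of_generate_finite _ generateFrom_squareCylinders.symm
    (isPiSystem_squareCylinders (fun _ => MeasurableSpace.isPiSystem_measurableSet)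
      fun _ => MeasurableSet.univ) ?_ ?_
  · rintro _ ⟨I, t, ht, rfl⟩
    simp only [Set.mem_univ_pi, Set.mem_ofPred_eq] at ht
    have hpi : MeasurableSet ((I : Set ℕ).pi t) := .pi I.countable_toSet fun i _ => ht i
    rw [Measure.bind_apply hpi hmeas.aemeasurable]
    simp only [Measure.infinitePi_pi _ fun i _ => ht i]
    obtain ⟨k, hk⟩ := I.exists_nat_subset_range
    classical
    -- Padding with `Set.univ` contributes factors 1 and extends the product over `I` to an initial
    -- segment.
    let s : ℕ → Set Z := fun i => if i ∈ I then t i else Set.univ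
    have hs : ∀ i, MeasurableSet (s i) := fun i => by
      by_cases h : i ∈ I <;> simp [s, h, ht i]
    have key := hR.integral_prod_indicator hs k (G := fun _ => 1) measurable_const (by simp)
    simp only [mul_one] at key
    have hL : ∀ z : ℕ → Z, ∏ i ∈ Finset.range k, ((s i).indicator 1 (z i) : ℝ) =
        ((I : Set ℕ).pi t).indicator 1 z := by
      intro z
      rw [← Finset.prod_subset hk fun i _ hi => by simp [s, hi]]
      by_cases hz : z ∈ (I : Set ℕ).pi t
      · rw [Set.indicator_of_mem hz]
        refine Finset.prod_eq_one fun i hi => ?_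
        simp [s, hi, hz i hi]
      · rw [Set.indicator_of_notMem hz]
        simp only [Set.mem_pi, not_forall] at hz
        obtain ⟨i, hi, hzi⟩ := hz
        exact Finset.prod_eq_zero hi (by simp [s, Finset.mem_coe.1 hi, hzi])
    have hP : ∀ z, ∏ i ∈ Finset.range k, (directingMeasure R z).real (s i) =
        (∏ i ∈ I, directingMeasure R z (t i)).toReal := by
      intro z
      rw [← Finset.prod_subset hk fun i _ hi => by simp [s, hi], ENNReal.toReal_prod]
      exact Finset.prod_congr rfl fun i hi => by simp [s, hi, Measure.real]
    simp only [hL, hP] at key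
    rw [integral_indicator_one hpi, integral_toReal] at key
    · rw [Measure.real, ENNReal.toReal_eq_toReal_iff' (measure_ne_top _ _)] at key
      · exact key
      · refine ne_top_of_le_ne_top ENNReal.one_ne_top ((lintegral_mono fun z =>
          Finset.prod_le_one' fun i _ => prob_le_one).trans (by simp))
    · exact (Finset.measurable_fun_prod _ fun i _ => (measurable_directingMeasure_apply R
        (ht i)).mono exchangeableSigmaAlgebra_le le_rfl).aemeasurable
    · exact ae_of_all _ fun z => ENNReal.prod_lt_top fun i _ => measure_lt_top _ _
  · rw [Measure.bind_apply .univ hmeas.aemeasurable]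
    simp

end ExchangeableSigmaAlgebra

/-! ### Comparison of the upper functionals -/

section UpperFunctionals

variable {Z : Type*} [MeasurableSpace Z]

instance (Q : ProbabilityMeasure Z) : IsProbabilityMeasure (iidMeasure Q) := by
  unfold iidMeasure
  infer_instance

/-- The preimage of a box under a swap is a box with permuted sides, and the product of the side
measures ignores their order. -/
theorem isExchangeable_iidMeasure (Q : ProbabilityMeasure Z) :
    IsExchangeable ⟨iidMeasure Q, inferInstance⟩ := by
  intro i j
  refine Measure.eq_infinitePi _ fun s t ht => ?_
  have hpre : (fun (z : ℕ → Z) n => z (Equiv.swap i j n)) ⁻¹' ((s : Set ℕ).pi t) =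
      ((s.map (Equiv.swap i j).toEmbedding : Finset ℕ) : Set ℕ).pi
        fun n => t (Equiv.swap i j n) := by
    ext z
    simp only [Set.mem_preimage, Set.mem_pi, Finset.coe_map, Set.forall_mem_image,
      Equiv.coe_toEmbedding, Equiv.swap_apply_self]
  rw [Measure.map_apply (measurable_swap_coords i j) (.pi s.countable_toSet fun i _ => ht i), hpre]
  simp only [ProbabilityMeasure.coe_mk, iidMeasure]
  rw [Measure.infinitePi_pi _ fun n _ => ht _, Finset.prod_map]
  simp

theorem UXE_eq_URE [StandardBorelSpace Z] {F : (ℕ → Z) → ℝ≥0∞} (hF : Measurable F) :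
    UXE F = URE F := by
  refine le_antisymm (iSup₂_le fun R hR => ?_) (iSup_le fun Q =>
    le_iSup₂_of_le (⟨iidMeasure Q, inferInstance⟩ : ProbabilityMeasure (ℕ → Z))
      (isExchangeable_iidMeasure Q) le_rfl)
  rw [hR.eq_bind, Measure.lintegral_bind (measurable_iid_directingMeasure R).aemeasurable
    hF.aemeasurable]
  calc _ ≤ ∫⁻ _, URE F ∂(R : Measure (ℕ → Z)) := lintegral_mono fun z =>
        le_iSup (fun Q : ProbabilityMeasure Z => ∫⁻ z, F z ∂(iidMeasure Q))
          ⟨directingMeasure R z, inferInstance⟩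
    _ = URE F := by simp

theorem UXP_eq_URP [StandardBorelSpace Z] {A : Set (ℕ → Z)} (hA : MeasurableSet A) :
    UXP A = URP A := by
  have h := UXE_eq_URE (F := A.indicator 1) (measurable_one.indicator hA)
  simp only [UXE, URE, lintegral_indicator_one hA] at h
  exact h

end UpperFunctionals

theorem mainTheorem3 {Z : Type*} [MeasurableSpace Z] [StandardBorelSpace Z] :
    (∀ A : Set (ℕ → Z), MeasurableSet A → UXP A = URP A) ∧
    (∀ F : (ℕ → Z) → ℝ≥0∞, Measurable F → UXE F = URE F) ∧
    (∀ ε ∈ Set.Ioo (0 : ℝ) 1, ∀ A : Set (ℕ → Z),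
      IsExchangeabilityCriticalRegion ε A ↔ IsRandomnessCriticalRegion ε A) ∧
    (∀ P : (ℕ → Z) → unitInterval,
      IsExchangeabilityPVariable P ↔ IsRandomnessPVariable P) ∧
    (∀ F : (ℕ → Z) → ℝ≥0∞,
      IsExchangeabilityEVariable F ↔ IsRandomnessEVariable F) := by
  refine ⟨fun A hA => UXP_eq_URP hA, fun F hF => UXE_eq_URE hF, fun ε _ A => ?_, fun P => ?_,
    fun F => ?_⟩
  · exact and_congr_right fun hA => by rw [UXP_eq_URP hA]
  · refine and_congr_right fun hP => forall₂_congr fun ε _ => ?_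
    have hA : MeasurableSet {z | (P z : ℝ) ≤ ε} :=
      measurableSet_le (measurable_subtype_coe.comp hP) measurable_const
    rw [UXP_eq_URP hA]
  · exact and_congr_right fun hF => by rw [UXE_eq_URE hF]
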